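/- Let $\xi_1,\xi_2,\dots$ be i.i.d. copies of a strictly positive random variable $\xi$ whose distribution function $G$ has a bounded density $g$ that is continuous on $(0,\infty)$ with $g(1/2)>0$. For $A\subseteq\{1,\dots,n\}$ put $$f_n(A)=|A|-\sum_{i=1}^{n-1}\xi_i\,\mathbf 1(i\in A,\ i+1\in A),\qquad M_n=\max_{A\subseteq\{1,\dots,n\}}f_n(A).$$ Then the Markov chain with transitions $x\mapsto\max(1-x,1-\xi)$ has a unique stationary probability law; it is carried by $[0,1]$ and, writing $\overline G=1-G$, its distribution function is $$F(x)=\frac{\overline G(1-x)\,G(x)}{1-\overline G(x)\,\overline G(1-x)}\qquad(x\in\mathbb R),$$ where the denominator is positive. Moreover there is a constant $c\in[1/2,1]$ such that $n^{-1}M_n\to c$ almost surely and in $L^1$ as $n\to\infty$, and $$c=\tfrac12+\tfrac12\,P\big(\xi<\min(X^L,X^R)\big)-E\big[\xi\,\mathbf 1\big(\xi<\min(X^L,X^R)\big)\big],$$ where $X^L,\xi,X^R$ are independent and $X^L,X^R$ have distribution function $F$. If $\xi$ is exponential with parameter $\lambda>0$, then $$c=(1-e^{-\lambda})^{-1}-\lambda^{-1}.$$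 -/

import Mathlib

open Set Filter Topology MeasureTheory ProbabilityTheory

/-- The benefit `f_n(A) = |A| - ∑_{i=1}^{n-1} x_i 1(i ∈ A, i+1 ∈ A)` of a set `A ⊆ {1, …, n}` of
items, for the costs `x_1, x_2, …` (the value `x 0` is never used). -/
def benefit (x : ℕ → ℝ) (n : ℕ) (A : Finset ℕ) : ℝ :=
  (A.card : ℝ) - ∑ i ∈ Finset.Ico 1 n, if i ∈ A ∧ i + 1 ∈ A then x i else 0

/-- The maximum benefit `M_n = max_{A ⊆ {1, …, n}} f_n(A)`. -/
noncomputable def maxBenefit (x : ℕ → ℝ) (n : ℕ) : ℝ :=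
  (Finset.Icc 1 n).powerset.sup' ⟨∅, Finset.empty_mem_powerset _⟩ (benefit x n)

/-- The transition kernel of the Markov chain `x ↦ max (1 - x) (1 - ξ)`, where `ξ` is a fresh
variable of law `ν`. -/
noncomputable def chainKernel (ν : Measure ℝ) [IsProbabilityMeasure ν] : Kernel ℝ ℝ :=
  (Kernel.id ×ₖ Kernel.const ℝ ν).map fun p : ℝ × ℝ => max (1 - p.1) (1 - p.2)

theorem chainKernel_apply (ν : Measure ℝ) [IsProbabilityMeasure ν] (x : ℝ) :
    chainKernel ν x = ν.map fun z => max (1 - x) (1 - z) := by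
  have h : Measurable fun p : ℝ × ℝ => max (1 - p.1) (1 - p.2) := by fun_prop
  rw [chainKernel, Kernel.map_apply _ h, Kernel.prod_apply, Kernel.id_apply, Kernel.const_apply,
    Measure.dirac_prod, Measure.map_map h (by fun_prop)]
  rfl

/-- `1/2 + 1/2 P(ξ < min(X, Y)) - E[ξ 1(ξ < min(X, Y))]` for independent `X, ξ, Y` of laws
`π, ν, π`; a point of the product space is `p = (X, ξ, Y)`.  The integrand has values in `[0, 1]`
almost surely when `ξ > 0` and `X ≤ 1` almost surely. -/
noncomputable def limitConst (ν π : Measure ℝ) : ℝ :=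
  1 / 2 + 1 / 2 * (π.prod (ν.prod π)).real {p | p.2.1 < min p.1 p.2.2}
    - ∫ p : ℝ × ℝ × ℝ, (if p.2.1 < min p.1 p.2.2 then p.2.1 else 0) ∂(π.prod (ν.prod π))

/-! Dynamic programming turns the optimisation into a Markov chain. With `s_n = M_{n+1} - M_n`, a
best set containing `n + 1` either omits `n` or pays `x n` for keeping it, so its value is `1 + max
(M_{n-1}) (M_n - x n)`. Hence `s_0 = 1`, `s_n = max (1 - s_{n-1}) (1 - x n)`, and the last item can
always be included because `s_n ≥ 0`. So `M_n` is a partial sum of the chain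
(`maxBenefit_eq_chainSum`).

No ergodic theorem is needed. One step reverses order and does not increase distances, so the
differences between two trajectories alternate in sign and shrink, and the partial sums differ by at
most the initial distance (`abs_chainSum_sub_le`). Restarting at `1` every `m` steps therefore costs
at most `1` per block. The restarted blocks are i.i.d., so the strong law applies, and comparison
with a stationary start puts the block mean within `1` of `m` times the stationary mean. Letting `m`
grow gives almost sure convergence; boundedness gives `L¹`.

Invariance relates the distribution function at `x` to its left limit at `1 - x` and conversely.
These two linear equations determine it, giving both uniqueness and the formula. The limit constant
follows by integrating the pointwise identity `posPart_sub_eq`, whose extra terms are antisymmetric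
in an i.i.d. pair. -/

/-! ### The chain and its partial sums for fixed costs -/

/-- The trajectory of the chain `s ↦ max (1 - s) (1 - ξ)` started at `s` and driven by
`x 1, x 2, …`. -/
noncomputable def chain (x : ℕ → ℝ) (s : ℝ) : ℕ → ℝ
  | 0 => s
  | k + 1 => max (1 - chain x s k) (1 - x (k + 1))

/-- The sum of the first `n` terms of the trajectory `chain x s`. -/
noncomputable def chainSum (x : ℕ → ℝ) (s : ℝ) (n : ℕ) : ℝ :=
  ∑ k ∈ Finset.range n, chain x s k

theorem chain_add (x : ℕ → ℝ) (s : ℝ) (p k : ℕ) :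
    chain x s (p + k) = chain (fun j => x (p + j)) (chain x s p) k := by
  induction k with
  | zero => rfl
  | succ k ih => rw [← add_assoc, chain, chain, ih, add_assoc]

theorem chainSum_succ (x : ℕ → ℝ) (s : ℝ) (n : ℕ) :
    chainSum x s (n + 1) = chainSum x s n + chain x s n := Finset.sum_range_succ _ _

theorem chainSum_add (x : ℕ → ℝ) (s : ℝ) (p k : ℕ) :
    chainSum x s (p + k)
      = chainSum x s p + chainSum (fun j => x (p + j)) (chain x s p) k := by
  simp only [chainSum, Finset.sum_range_add, chain_add]

theorem chain_congr {x y : ℕ → ℝ} {s : ℝ} {n : ℕ} (h : ∀ k, 1 ≤ k → k ≤ n → x k = y k) :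
    chain x s n = chain y s n := by
  induction n with
  | zero => rfl
  | succ n ih =>
    rw [chain, chain, ih fun k h1 h2 => h k h1 (by omega), h _ (by omega) le_rfl]

theorem chainSum_congr {x y : ℕ → ℝ} {s : ℝ} {n : ℕ} (h : ∀ k, 1 ≤ k → k < n → x k = y k) :
    chainSum x s n = chainSum y s n :=
  Finset.sum_congr rfl fun _ hk => chain_congr fun j h1 h2 =>
    h j h1 (lt_of_le_of_lt h2 (Finset.mem_range.1 hk))

theorem chain_mem_Icc {x : ℕ → ℝ} (hx : ∀ k, 1 ≤ k → 0 ≤ x k) {s : ℝ} (hs : s ∈ Icc (0 : ℝ) 1)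
    (n : ℕ) : chain x s n ∈ Icc (0 : ℝ) 1 := by
  induction n with
  | zero => exact hs
  | succ n ih =>
    have := hx (n + 1) (by omega)
    exact ⟨le_max_of_le_left (by linarith [ih.2]), max_le (by linarith [ih.1]) (by linarith)⟩

/-- After one step the two starting points are in reversed order and at most `t - s` apart. The
difference of sums is `t - s` minus a tail difference, which by induction lies in `[0, t - s]`. -/
theorem chainSum_mono_nonexpansive (n : ℕ) : ∀ (x : ℕ → ℝ) {s t : ℝ}, s ≤ t →
    chainSum x s n ≤ chainSum x t n ∧ chainSum x t n - chainSum x s n ≤ t - s := by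
  induction n with
  | zero => intro x s t h; simp [chainSum, h]
  | succ n ih =>
    intro x s t h
    have key : max (1 - t) (1 - x 1) ≤ max (1 - s) (1 - x 1) :=
      max_le_max_right _ (by linarith)
    have key' : max (1 - s) (1 - x 1) ≤ max (1 - t) (1 - x 1) + (t - s) :=
      max_le (by linarith [le_max_left (1 - t) (1 - x 1)])
        (by linarith [le_max_right (1 - t) (1 - x 1)])
    have e : ∀ r, chainSum x r (n + 1)
        = r + chainSum (fun j => x (1 + j)) (max (1 - r) (1 - x 1)) n := by
      intro r
      rw [add_comm n 1, chainSum_add]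
      simp [chainSum, chain]
    obtain ⟨h1, h2⟩ := ih (fun j => x (1 + j)) key
    rw [e, e]
    constructor <;> linarith

theorem abs_chainSum_sub_le (x : ℕ → ℝ) (s t : ℝ) (n : ℕ) :
    |chainSum x s n - chainSum x t n| ≤ |s - t| := by
  rcases le_total s t with h | h
  · obtain ⟨h1, h2⟩ := chainSum_mono_nonexpansive n x h
    rw [abs_sub_comm, abs_sub_comm s, abs_of_nonneg (by linarith), abs_of_nonneg (by linarith)]
    exact h2
  · obtain ⟨h1, h2⟩ := chainSum_mono_nonexpansive n x h
    rw [abs_of_nonneg (by linarith), abs_of_nonneg (by linarith)]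
    exact h2

/-- Restarting the chain at `1` after each block of length `m` costs at most `1` per block. -/
theorem abs_chainSum_mul_sub_le {x : ℕ → ℝ} (hx : ∀ k, 1 ≤ k → 0 ≤ x k) (m j : ℕ) :
    |chainSum x 1 (j * m) - ∑ i ∈ Finset.range j, chainSum (fun k => x (i * m + k)) 1 m|
      ≤ j := by
  induction j with
  | zero => simp [chainSum]
  | succ j ih =>
    have h1 := abs_chainSum_sub_le (fun k => x (j * m + k)) (chain x 1 (j * m)) 1 m
    have h2 := chain_mem_Icc hx (s := 1) (by simp) (j * m)
    have h3 : |chain x 1 (j * m) - 1| ≤ 1 := by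
      rw [abs_le]; constructor <;> linarith [h2.1, h2.2]
    rw [Nat.succ_mul, chainSum_add, Finset.sum_range_succ, add_sub_add_comm]
    push_cast
    exact (abs_add_le _ _).trans (add_le_add ih (h1.trans h3))

theorem chainSum_le_chainSum_add {x : ℕ → ℝ} (hx : ∀ k, 1 ≤ k → 0 ≤ x k) (p r : ℕ) :
    chainSum x 1 p ≤ chainSum x 1 (p + r) ∧ chainSum x 1 (p + r) ≤ chainSum x 1 p + r := by
  induction r with
  | zero => simp
  | succ r ih =>
    have h := chain_mem_Icc hx (s := 1) (by simp) (p + r)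
    rw [← add_assoc, chainSum_succ]
    push_cast
    exact ⟨by linarith [h.1], by linarith [h.2]⟩

theorem chainSum_mem_Icc {x : ℕ → ℝ} (hx : ∀ k, 1 ≤ k → 0 ≤ x k) (n : ℕ) :
    chainSum x 1 n ∈ Icc (0 : ℝ) n := by
  have h := chainSum_le_chainSum_add hx 0 n
  simpa [chainSum] using h

/-! ### The maximum benefit as a partial sum of the chain -/

theorem benefit_insert {x : ℕ → ℝ} {n : ℕ} (hn : 1 ≤ n) {A : Finset ℕ} (hA : A ⊆ Finset.Icc 1 n) :
    benefit x (n + 1) (insert (n + 1) A) = 1 + benefit x n A - if n ∈ A then x n else 0 := by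
  have hnA : n + 1 ∉ A := fun h => by have := Finset.mem_Icc.1 (hA h); omega
  have h : ∑ i ∈ Finset.Ico 1 n,
      (if i ∈ insert (n + 1) A ∧ i + 1 ∈ insert (n + 1) A then x i else 0)
      = ∑ i ∈ Finset.Ico 1 n, (if i ∈ A ∧ i + 1 ∈ A then x i else 0) := by
    refine Finset.sum_congr rfl fun i hi => ?_
    have := Finset.mem_Ico.1 hi
    simp [show i ≠ n + 1 by omega, show i ≠ n by omega]
  rw [benefit, benefit, Finset.card_insert_of_notMem hnA, Finset.sum_Ico_succ_top hn, h]
  simp only [Finset.mem_insert, true_or, and_true, show n ≠ n + 1 by omega, false_or]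
  push_cast
  ring

theorem benefit_succ_of_subset {x : ℕ → ℝ} {n : ℕ} {A : Finset ℕ} (hA : A ⊆ Finset.Icc 1 n) :
    benefit x (n + 1) A = benefit x n A := by
  have hnA : n + 1 ∉ A := fun h => by have := Finset.mem_Icc.1 (hA h); omega
  rcases Nat.eq_zero_or_pos n with rfl | hn
  · simp [benefit]
  · simp [benefit, Finset.sum_Ico_succ_top (show 1 ≤ n from hn), hnA]

theorem Finset.subset_Icc_of_subset_succ {n : ℕ} {A : Finset ℕ} (hA : A ⊆ Finset.Icc 1 (n + 1))
    (h : n + 1 ∉ A) : A ⊆ Finset.Icc 1 n := fun i hi => by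
  have h1 := Finset.mem_Icc.1 (hA hi)
  have h2 : i ≠ n + 1 := fun e => h (e ▸ hi)
  exact Finset.mem_Icc.2 ⟨h1.1, by omega⟩

theorem benefit_le_chainSum {x : ℕ → ℝ} (hx : ∀ k, 1 ≤ k → 0 ≤ x k) (n : ℕ) :
    ∀ A ⊆ Finset.Icc 1 n, benefit x n A ≤ chainSum x 1 n := by
  -- The second clause is needed to add item `n + 1` to a set without `n`: no cost is paid, and the
  -- bound must then start from the sum at `n - 1`.
  have key : ∀ n, ∀ A ⊆ Finset.Icc 1 n, benefit x n A ≤ chainSum x 1 n ∧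
      (n ∉ A → benefit x n A ≤ chainSum x 1 (n - 1)) := by
    intro n
    induction n with
    | zero =>
      intro A hA
      have : A = ∅ := by simpa using hA
      simp [this, benefit, chainSum]
    | succ n ih =>
      intro A hA
      have hc := chain_mem_Icc hx (s := 1) (by simp) n
      by_cases h : n + 1 ∈ A
      · refine ⟨?_, fun h' => absurd h h'⟩
        set B := A.erase (n + 1) with hB
        have hBA : A = insert (n + 1) B := (Finset.insert_erase h).symm
        have hBs : B ⊆ Finset.Icc 1 n := Finset.subset_Icc_of_subset_succ
          ((Finset.erase_subset _ _).trans hA) (Finset.notMem_erase _ _)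
        rcases n with _ | n
        · have : B = ∅ := by simpa using hBs
          rw [hBA, this]
          simp [benefit, chainSum, chain]
        · rw [hBA, benefit_insert (by omega) hBs, chainSum_succ]
          obtain ⟨h1, h2⟩ := ih B hBs
          by_cases hn : n + 1 ∈ B
          · rw [if_pos hn, chain]
            linarith [le_max_right (1 - chain x 1 n) (1 - x (n + 1))]
          · have h3 := h2 hn
            rw [if_neg hn, chain, chainSum_succ]
            rw [Nat.add_sub_cancel] at h3
            linarith [le_max_left (1 - chain x 1 n) (1 - x (n + 1))]
      · have hA' := Finset.subset_Icc_of_subset_succ hA h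
        rw [benefit_succ_of_subset hA', chainSum_succ, Nat.add_sub_cancel]
        have := (ih A hA').1
        exact ⟨by linarith [hc.1], fun _ => this⟩
  exact fun A hA => (key n A hA).1

/-- The larger term of the maximum decides whether the previous item is kept at its cost or skipped,
in which case an optimal set two steps back is extended. Hence the strong induction. -/
theorem exists_benefit_eq_chainSum (x : ℕ → ℝ) (n : ℕ) : ∃ A ⊆ Finset.Icc 1 (n + 1),
    n + 1 ∈ A ∧ benefit x (n + 1) A = chainSum x 1 (n + 1) := by
  induction n using Nat.strong_induction_on with
  | _ n ih =>
    rcases n with _ | n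
    · exact ⟨{1}, by simp, by simp, by simp [benefit, chainSum, chain]⟩
    · have hins : ∀ A ⊆ Finset.Icc 1 (n + 1),
          insert (n + 1 + 1) A ⊆ Finset.Icc 1 (n + 1 + 1) := fun A hA => by
        refine Finset.insert_subset (by simp) (hA.trans (Finset.Icc_subset_Icc_right (by omega)))
      rcases le_total (1 - chain x 1 n) (1 - x (n + 1)) with h | h
      · obtain ⟨A, hA, hmem, hb⟩ := ih n (by omega)
        refine ⟨insert (n + 1 + 1) A, hins A hA, Finset.mem_insert_self _ _, ?_⟩
        rw [benefit_insert (by omega) hA, if_pos hmem, hb, chainSum_succ x 1 (n + 1), chain,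
          max_eq_right h]
        ring
      · have : ∃ A ⊆ Finset.Icc 1 n, benefit x n A = chainSum x 1 n := by
          rcases n with _ | n
          · exact ⟨∅, by simp, by simp [benefit, chainSum]⟩
          · obtain ⟨A, hA, -, hb⟩ := ih n (by omega)
            exact ⟨A, hA, hb⟩
        obtain ⟨A, hA, hb⟩ := this
        have hA' : A ⊆ Finset.Icc 1 (n + 1) := hA.trans (Finset.Icc_subset_Icc_right (by omega))
        have hn : n + 1 ∉ A := fun h => by have := Finset.mem_Icc.1 (hA h); omega
        refine ⟨insert (n + 1 + 1) A, hins A hA', Finset.mem_insert_self _ _, ?_⟩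
        rw [benefit_insert (by omega) hA', if_neg hn, benefit_succ_of_subset hA, hb,
          chainSum_succ x 1 (n + 1), chainSum_succ x 1 n, chain, max_eq_left h]
        ring

theorem maxBenefit_eq_chainSum {x : ℕ → ℝ} (hx : ∀ k, 1 ≤ k → 0 ≤ x k) (n : ℕ) :
    maxBenefit x n = chainSum x 1 n := by
  apply le_antisymm
  · exact Finset.sup'_le _ _ fun A hA => benefit_le_chainSum hx n A (Finset.mem_powerset.1 hA)
  · rcases n with _ | n
    · simp [maxBenefit, benefit, chainSum]
    · obtain ⟨A, hA, -, hb⟩ := exists_benefit_eq_chainSum x n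
      rw [← hb]
      exact Finset.le_sup' (benefit x (n + 1)) (Finset.mem_powerset.2 hA)

/-! ### From block averages to a limit -/

/-- If, for each block length `m`, the block averages of a sequence `M` with increments in `[0, 1]`
converge up to a bounded error, then `M n / n` converges. -/
theorem tendsto_div_of_block_averages {M : ℕ → ℝ} {c : ℝ}
    (hM : ∀ p r : ℕ, M p ≤ M (p + r) ∧ M (p + r) ≤ M p + r)
    (hblock : ∀ m : ℕ, 1 ≤ m → ∃ (L : ℝ) (y : ℕ → ℝ), |L - m * c| ≤ 1 ∧
      Tendsto y atTop (𝓝 L) ∧ ∀ j : ℕ, |M (j * m) - j * y j| ≤ j) :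
    Tendsto (fun n : ℕ => M n / (n : ℝ)) atTop (𝓝 c) := by
  rw [Metric.tendsto_atTop]
  intro ε hε
  -- The error per block is at most `3`: one from `hb`, one from `y j` against `L`, one from `L`
  -- against `m * c`. As `j ≤ n / m`, taking `m > 6 / ε` keeps the total below `ε / 2 * n`; `N`
  -- makes the incomplete last block equally harmless.
  obtain ⟨m, hm⟩ := exists_nat_gt (6 / ε)
  have hm0 : 0 < (m : ℝ) := lt_trans (by positivity) hm
  have hm1 : 1 ≤ m := by exact_mod_cast hm0
  obtain ⟨L, y, hL, hy, hb⟩ := hblock m hm1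
  obtain ⟨J, hJ⟩ := Metric.tendsto_atTop.1 hy 1 one_pos
  obtain ⟨N, hN⟩ := exists_nat_gt (2 * (m * (1 + |c|)) / ε)
  refine ⟨max (max N (J * m)) 1, fun n hn => ?_⟩
  have hn1 : 1 ≤ n := le_trans (le_max_right _ _) hn
  have hnN : N ≤ n := le_trans ((le_max_left _ _).trans (le_max_left _ _)) hn
  have hnJ : J * m ≤ n := le_trans ((le_max_right _ _).trans (le_max_left _ _)) hn
  have hn0 : 0 < (n : ℝ) := by exact_mod_cast hn1
  set j := n / m
  set r := n % m
  have hjr : j * m + r = n := by rw [mul_comm]; exact Nat.div_add_mod n m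
  have hjr' : (j : ℝ) * m + r = n := by exact_mod_cast hjr
  have hr : (r : ℝ) ≤ m := by exact_mod_cast (Nat.mod_lt n hm1).le
  have hJj : J ≤ j := (Nat.le_div_iff_mul_le hm1).2 hnJ
  have h1 := hJ j hJj
  rw [Real.dist_eq] at h1
  have h2 := hb j
  have h3 := hM (j * m) r
  rw [hjr] at h3
  have hj0 : (0 : ℝ) ≤ j := by positivity
  have h4 : |(j : ℝ) * y j - j * (m * c)| ≤ 2 * j := by
    rw [← mul_sub, abs_mul, abs_of_nonneg hj0, mul_comm 2]
    refine mul_le_mul_of_nonneg_left ?_ hj0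
    have := abs_sub_le (y j) L (m * c)
    linarith
  have h5 : |(r : ℝ) * c| ≤ m * |c| := by
    rw [abs_mul, abs_of_nonneg (Nat.cast_nonneg r)]
    exact mul_le_mul_of_nonneg_right hr (abs_nonneg c)
  have hr0 : (0 : ℝ) ≤ r := by positivity
  have h6 : |M n - n * c| ≤ 3 * j + m * (1 + |c|) := by
    rw [abs_le] at h2 h4 h5 ⊢
    have e : (n : ℝ) * c = j * (m * c) + r * c := by rw [← hjr']; ring
    rw [e]
    constructor <;> nlinarith
  have h7 : 3 * (j : ℝ) ≤ ε / 2 * n := by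
    have : 6 < m * ε := by rwa [div_lt_iff₀ hε] at hm
    nlinarith
  have h8 : m * (1 + |c|) < ε / 2 * n := by
    have : 2 * (m * (1 + |c|)) < N * ε := by rwa [div_lt_iff₀ hε] at hN
    have : (N : ℝ) ≤ n := by exact_mod_cast hnN
    nlinarith
  rw [Real.dist_eq, show M n / n - c = (M n - n * c) / n by field_simp, abs_div,
    abs_of_pos hn0, div_lt_iff₀ hn0]
  linarith

/-! ### Distribution functions of invariant laws -/

theorem bind_chainKernel (ρ ν : Measure ℝ) [IsProbabilityMeasure ρ] [IsProbabilityMeasure ν] :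
    ρ.bind (chainKernel ν) = (ρ.prod ν).map fun p => max (1 - p.1) (1 - p.2) := by
  have h : Measurable fun p : ℝ × ℝ => max (1 - p.1) (1 - p.2) := by fun_prop
  rw [chainKernel, ← Measure.map_comp _ _ h, ← Measure.compProd_eq_comp_prod,
    Measure.compProd_const]

instance isMarkovKernel_chainKernel (ν : Measure ℝ) [IsProbabilityMeasure ν] :
    IsMarkovKernel (chainKernel ν) :=
  Kernel.IsMarkovKernel.map _ (by fun_prop)

theorem bind_chainKernel_Iic (ρ ν : Measure ℝ) [IsProbabilityMeasure ρ] [IsProbabilityMeasure ν]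
    (x : ℝ) : (ρ.bind (chainKernel ν)).real (Iic x)
      = ρ.real (Ici (1 - x)) * ν.real (Ici (1 - x)) := by
  rw [bind_chainKernel, map_measureReal_apply (by fun_prop) measurableSet_Iic,
    ← measureReal_prod_prod]
  congr 1
  ext p
  simp only [mem_preimage, mem_Iic, max_le_iff, mem_prod, mem_Ici, sub_le_comm]

/-- The companion with strict inequalities: an invariant law is not known in advance to be atomless,
so its left limits enter as separate unknowns. -/
theorem bind_chainKernel_Iio (ρ ν : Measure ℝ) [IsProbabilityMeasure ρ] [IsProbabilityMeasure ν]
    (x : ℝ) : (ρ.bind (chainKernel ν)).real (Iio x)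
      = ρ.real (Ioi (1 - x)) * ν.real (Ioi (1 - x)) := by
  rw [bind_chainKernel, map_measureReal_apply (by fun_prop) measurableSet_Iio,
    ← measureReal_prod_prod]
  congr 1
  ext p
  simp only [mem_preimage, mem_Iio, max_lt_iff, mem_prod, mem_Ioi, sub_lt_comm]

theorem measureReal_Ioi_eq (ρ : Measure ℝ) [IsProbabilityMeasure ρ] (x : ℝ) :
    ρ.real (Ioi x) = 1 - cdf ρ x := by
  rw [← compl_Iic, probReal_compl_eq_one_sub measurableSet_Iic, cdf_eq_real]

theorem measureReal_Ici_eq (ρ : Measure ℝ) [IsProbabilityMeasure ρ] (x : ℝ) :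
    ρ.real (Ici x) = 1 - ρ.real (Iio x) := by
  rw [← compl_Iio, probReal_compl_eq_one_sub measurableSet_Iio]

theorem measureReal_Iio_eq (ρ : Measure ℝ) [IsProbabilityMeasure ρ] [NullSingletonClass ρ] (x : ℝ) :
    ρ.real (Iio x) = cdf ρ x := by
  rw [cdf_eq_real, measureReal_congr Iio_ae_eq_Iic]

/-- One of `x` and `1 - x` is at least `1/2`, so one of the two factors is less than `1`. -/
theorem cdf_survival_mul_lt_one (ν : Measure ℝ) (hG : 0 < cdf ν (1 / 2)) (x : ℝ) :
    (1 - cdf ν x) * (1 - cdf ν (1 - x)) < 1 := by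
  have h1 := cdf_nonneg ν x
  have h2 := cdf_nonneg ν (1 - x)
  have h3 := cdf_le_one ν x
  have h4 := cdf_le_one ν (1 - x)
  rcases le_total (1 / 2) x with h | h
  · have := monotone_cdf ν h
    nlinarith
  · have := monotone_cdf ν (show 1 / 2 ≤ 1 - x by linarith)
    nlinarith

/-- An invariant law of the chain has an explicit distribution function. -/
theorem cdf_of_invariant (ν : Measure ℝ) [IsProbabilityMeasure ν] [NullSingletonClass ν]
    (hG : 0 < cdf ν (1 / 2)) (ρ : Measure ℝ) [IsProbabilityMeasure ρ]
    (hρ : (chainKernel ν).Invariant ρ) (x : ℝ) :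
    cdf ρ x = (1 - cdf ν (1 - x)) * cdf ν x / (1 - (1 - cdf ν x) * (1 - cdf ν (1 - x))) := by
  -- Two linear equations in the unknowns `cdf ρ x` and `ρ.real (Iio (1 - x))`; the second is
  -- eliminated.
  have h1 := bind_chainKernel_Iic ρ ν x
  have h2 := bind_chainKernel_Iio ρ ν (1 - x)
  rw [hρ.def, measureReal_Ici_eq, measureReal_Ici_eq ν, measureReal_Iio_eq ν, ← cdf_eq_real] at h1
  rw [hρ.def, measureReal_Ioi_eq, measureReal_Ioi_eq ν, sub_sub_cancel] at h2
  have := cdf_survival_mul_lt_one ν hG x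
  rw [eq_div_iff (by linarith)]
  rw [h2] at h1
  linear_combination h1

/-! ### Construction and uniqueness of the stationary law -/

theorem continuous_cdf (ν : Measure ℝ) [IsProbabilityMeasure ν] [NullSingletonClass ν] :
    Continuous (cdf ν) := by
  rw [continuous_iff_continuousAt]
  intro x
  rw [(monotone_cdf ν).continuousAt_iff_leftLim_eq_rightLim]
  have h := (cdf ν).measure_singleton x
  rw [measure_cdf, measure_singleton] at h
  have h2 := ENNReal.ofReal_eq_zero.1 h.symm
  rw [StieltjesFunction.rightLim_eq]
  exact le_antisymm ((monotone_cdf ν).leftLim_le le_rfl) (by linarith)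

theorem survival_ratio_mono {a b a' b' : ℝ} (ha : 0 ≤ a) (haa : a ≤ a') (ha' : a' ≤ 1)
    (hbb : b' ≤ b) (hb : b ≤ 1) (h : b * a < 1) (h' : b' * a' < 1) :
    a * (1 - b) / (1 - b * a) ≤ a' * (1 - b') / (1 - b' * a') := by
  rw [div_le_div_iff₀ (by linarith) (by linarith)]
  -- After cross-multiplication the difference of the two sides is exactly `(a' - a) * (1 - b) + a'
  -- * (b - b') * (1 - a)`.
  nlinarith [mul_nonneg (sub_nonneg.2 haa) (sub_nonneg.2 hb),
    mul_nonneg (mul_nonneg (ha.trans haa) (sub_nonneg.2 hbb)) (sub_nonneg.2 (haa.trans ha'))]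

/-- The distribution function of the stationary law of the chain. -/
noncomputable def stationaryCdf (ν : Measure ℝ) [IsProbabilityMeasure ν] [NullSingletonClass ν]
    (hG : 0 < cdf ν (1 / 2)) : StieltjesFunction ℝ where
  toFun x := (1 - cdf ν (1 - x)) * cdf ν x / (1 - (1 - cdf ν x) * (1 - cdf ν (1 - x)))
  mono' x y hxy := by
    have h := survival_ratio_mono (a := 1 - cdf ν (1 - x)) (a' := 1 - cdf ν (1 - y))
      (b := 1 - cdf ν x) (b' := 1 - cdf ν y)
      (by linarith [cdf_le_one ν (1 - x)])
      (by linarith [monotone_cdf ν (show 1 - y ≤ 1 - x by linarith)])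
      (by linarith [cdf_nonneg ν (1 - y)])
      (by linarith [monotone_cdf ν hxy]) (by linarith [cdf_nonneg ν x])
      (cdf_survival_mul_lt_one ν hG x) (cdf_survival_mul_lt_one ν hG y)
    simpa only [sub_sub_cancel] using h
  right_continuous' x := by
    have h := continuous_cdf ν
    have h' : Continuous fun x => cdf ν (1 - x) := h.comp (by fun_prop)
    refine Continuous.continuousWithinAt (Continuous.div₀ (by fun_prop) (by fun_prop) fun x => ?_)
    linarith [cdf_survival_mul_lt_one ν hG x]

section Stationary

variable (ν : Measure ℝ) [IsProbabilityMeasure ν] [NullSingletonClass ν] (hG : 0 < cdf ν (1 / 2))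

theorem stationaryCdf_apply (x : ℝ) : stationaryCdf ν hG x
    = (1 - cdf ν (1 - x)) * cdf ν x / (1 - (1 - cdf ν x) * (1 - cdf ν (1 - x))) := rfl

theorem continuous_stationaryCdf : Continuous (stationaryCdf ν hG) := by
  have h := continuous_cdf ν
  have h' : Continuous fun x => cdf ν (1 - x) := h.comp (by fun_prop)
  refine Continuous.div₀ (by fun_prop) (by fun_prop) fun x => ?_
  linarith [cdf_survival_mul_lt_one ν hG x]

theorem tendsto_stationaryCdf_atBot : Tendsto (stationaryCdf ν hG) atBot (𝓝 0) := by
  have h1 := tendsto_cdf_atBot ν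
  have h2 : Tendsto (fun x => cdf ν (1 - x)) atBot (𝓝 1) :=
    (tendsto_cdf_atTop ν).comp (tendsto_atTop_add_const_left _ 1 tendsto_neg_atBot_atTop)
  have h := ((h2.const_sub 1).mul h1).div (((h1.const_sub 1).mul (h2.const_sub 1)).const_sub 1)
    (by norm_num)
  norm_num at h
  exact h

theorem tendsto_stationaryCdf_atTop : Tendsto (stationaryCdf ν hG) atTop (𝓝 1) := by
  have h1 := tendsto_cdf_atTop ν
  have h2 : Tendsto (fun x => cdf ν (1 - x)) atTop (𝓝 0) :=
    (tendsto_cdf_atBot ν).comp (tendsto_atBot_add_const_left _ 1 tendsto_neg_atTop_atBot)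
  have h := ((h2.const_sub 1).mul h1).div (((h1.const_sub 1).mul (h2.const_sub 1)).const_sub 1)
    (by norm_num)
  norm_num at h
  exact h

/-- The stationary law of the chain. -/
noncomputable def stationaryLaw : Measure ℝ := (stationaryCdf ν hG).measure

instance isProbabilityMeasure_stationaryLaw : IsProbabilityMeasure (stationaryLaw ν hG) :=
  StieltjesFunction.isProbabilityMeasure _ (tendsto_stationaryCdf_atBot ν hG)
    (tendsto_stationaryCdf_atTop ν hG)

instance nullSingletonClass_stationaryLaw : NullSingletonClass (stationaryLaw ν hG) where
  measure_singleton x := by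
    rw [stationaryLaw, StieltjesFunction.measure_singleton,
      (continuous_stationaryCdf ν hG).continuousAt.continuousWithinAt.leftLim_eq]
    simp

theorem cdf_stationaryLaw (x : ℝ) : cdf (stationaryLaw ν hG) x
    = (1 - cdf ν (1 - x)) * cdf ν x / (1 - (1 - cdf ν x) * (1 - cdf ν (1 - x))) := by
  rw [stationaryLaw, cdf_measure_stieltjesFunction _ (tendsto_stationaryCdf_atBot ν hG)
    (tendsto_stationaryCdf_atTop ν hG), stationaryCdf_apply]

theorem invariant_stationaryLaw : (chainKernel ν).Invariant (stationaryLaw ν hG) := by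
  refine Measure.eq_of_cdf _ _ ?_
  ext x
  rw [cdf_eq_real, bind_chainKernel_Iic, measureReal_Ici_eq, measureReal_Ici_eq ν,
    measureReal_Iio_eq, measureReal_Iio_eq, cdf_stationaryLaw, cdf_stationaryLaw, sub_sub_cancel]
  have h := cdf_survival_mul_lt_one ν hG x
  have h'' : 1 - (1 - cdf ν x) * (1 - cdf ν (1 - x)) ≠ 0 := by linarith
  rw [mul_comm (1 - cdf ν (1 - x)) (1 - cdf ν x), one_sub_div h'', div_mul_eq_mul_div]
  congr 1
  ring

theorem eq_stationaryLaw_of_invariant (ρ : Measure ℝ) [IsProbabilityMeasure ρ]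
    (hρ : (chainKernel ν).Invariant ρ) : ρ = stationaryLaw ν hG := by
  refine Measure.eq_of_cdf _ _ ?_
  ext x
  rw [cdf_of_invariant ν hG ρ hρ, cdf_stationaryLaw]

theorem stationaryLaw_Icc (h0 : cdf ν 0 = 0) : stationaryLaw ν hG (Icc 0 1) = 1 := by
  have h1 : cdf (stationaryLaw ν hG) 1 = 1 := by
    have : 0 < cdf ν 1 := hG.trans_le (monotone_cdf ν (by norm_num))
    rw [cdf_stationaryLaw]
    simp [h0, this.ne']
  have h2 : cdf (stationaryLaw ν hG) 0 = 0 := by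
    rw [cdf_stationaryLaw]
    simp [h0]
  rw [← Iic_sdiff_Iio, measure_sdiff (Iio_subset_Iic zero_le_one)
    measurableSet_Iio.nullMeasurableSet (measure_ne_top _ _), measure_congr Iio_ae_eq_Iic,
    ← ofReal_cdf, ← ofReal_cdf, h1, h2]
  simp

end Stationary

/-! ### The stationary mean as the limit constant -/

theorem integral_prod_eq_zero_of_swap_eq_neg {π : Measure ℝ} [SFinite π] {h : ℝ × ℝ → ℝ}
    (hh : ∀ p, h p.swap = -h p) : ∫ p, h p ∂(π.prod π) = 0 := by
  have h1 := integral_prod_swap (μ := π) (ν := π) h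
  simp only [hh, integral_neg] at h1
  linarith

/-- The pointwise identity behind the formula for the limit constant, outside the ties `z = x`. -/
theorem posPart_sub_eq {x z y : ℝ} (hzx : z ≠ x) :
    y - 1 + max (1 - y) (1 - z) = (if z < min x y then 1 else 0)
      - 2 * (if z < min x y then z else 0)
      - (if 1 < max (1 - x) (1 - z) + y then max (1 - x) (1 - z) - y else 0)
      - (if x + max (1 - y) (1 - z) < 1 then x - max (1 - y) (1 - z) else 0) := by
  rcases lt_or_gt_of_ne hzx with h | h
  · rw [max_eq_right (show 1 - x ≤ 1 - z by linarith)]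
    rcases lt_or_ge z y with h2 | h2
    · rw [max_eq_right (show 1 - y ≤ 1 - z by linarith), if_pos (lt_min h h2),
        if_pos (lt_min h h2), if_pos (by linarith), if_neg (by linarith)]
      ring
    · have h3 : ¬ z < min x y := fun h' => absurd (h'.trans_le (min_le_right _ _)) (not_lt.2 h2)
      rw [max_eq_left (show 1 - z ≤ 1 - y by linarith), if_neg h3, if_neg h3,
        if_neg (by linarith), if_neg (by linarith)]
      ring
  · have h3 : ¬ z < min x y := fun h' => absurd (h'.trans_le (min_le_left _ _)) (not_lt.2 h.le)
    rw [max_eq_left (show 1 - z ≤ 1 - x by linarith), if_neg h3, if_neg h3]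
    rcases le_or_gt y x with h2 | h2
    · rw [max_eq_left (show 1 - z ≤ 1 - y by linarith), if_neg (by linarith),
        if_neg (by linarith)]
      ring
    · rcases le_total (1 - y) (1 - z) with h4 | h4
      · rw [max_eq_right h4, if_pos (by linarith), if_pos (by linarith)]
        ring
      · rw [max_eq_left h4, if_pos (by linarith), if_pos (by linarith)]
        ring

section Invariant

variable {ν π : Measure ℝ} [IsProbabilityMeasure ν] [IsProbabilityMeasure π]

theorem measurePreserving_of_invariant (hinv : (chainKernel ν).Invariant π) :
    MeasurePreserving (fun p : ℝ × ℝ => max (1 - p.1) (1 - p.2)) (π.prod ν) π :=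
  ⟨by fun_prop, by rw [← bind_chainKernel, hinv.def]⟩

theorem integrable_id_of_ae_mem (hsupp : ∀ᵐ x ∂π, x ∈ Icc (0 : ℝ) 1) :
    Integrable (fun x => x) π :=
  Integrable.of_bound (by fun_prop) 1 <| by
    filter_upwards [hsupp] with x hx
    rw [Real.norm_eq_abs, abs_of_nonneg hx.1]
    exact hx.2

theorem mean_le_one (hsupp : ∀ᵐ x ∂π, x ∈ Icc (0 : ℝ) 1) : ∫ x, x ∂π ≤ 1 := by
  have := integral_mono_ae (integrable_id_of_ae_mem hsupp) (integrable_const 1)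
    (hsupp.mono fun x hx => hx.2)
  simpa using this

/-- By stationarity the mean of `X` is that of `max (1 - X) (1 - ξ)`, which is at least one minus
the mean. -/
theorem half_le_mean (hinv : (chainKernel ν).Invariant π)
    (hsupp : ∀ᵐ x ∂π, x ∈ Icc (0 : ℝ) 1) : 1 / 2 ≤ ∫ x, x ∂π := by
  have hint := integrable_id_of_ae_mem hsupp
  have hm := measurePreserving_of_invariant hinv
  have h1 : ∫ p : ℝ × ℝ, max (1 - p.1) (1 - p.2) ∂(π.prod ν) = ∫ x, x ∂π := by
    rw [← hm.map_eq, integral_map hm.measurable.aemeasurable (by fun_prop), hm.map_eq]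
  have h2 : ∫ p : ℝ × ℝ, 1 - p.1 ∂(π.prod ν) = 1 - ∫ x, x ∂π := by
    rw [integral_sub (integrable_const _) (hint.comp_fst ν), integral_fun_fst (fun x => x)]
    simp
  have h3 : ∫ p : ℝ × ℝ, 1 - p.1 ∂(π.prod ν)
      ≤ ∫ p : ℝ × ℝ, max (1 - p.1) (1 - p.2) ∂(π.prod ν) :=
    integral_mono ((integrable_const _).sub (hint.comp_fst ν))
      (hm.integrable_comp_of_integrable hint) fun p => le_max_left _ _
  linarith

/-- The identity `posPart_sub_eq` is integrated over `(X, ξ, Y)`; ties are null since `ν` has no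
atoms. The left side gives twice the mean minus `1`. The last two terms on the right vanish: by
invariance each is the integral of an antisymmetric function against `π.prod π`. -/
theorem mean_eq_limitConst [NullSingletonClass ν] (hpos : ∀ᵐ z ∂ν, 0 < z)
    (hinv : (chainKernel ν).Invariant π) (hsupp : ∀ᵐ x ∂π, x ∈ Icc (0 : ℝ) 1) :
    ∫ x, x ∂π = limitConst ν π := by
  have hint := integrable_id_of_ae_mem hsupp
  have hm := measurePreserving_of_invariant hinv
  have hswap : MeasurePreserving (fun p : ℝ × ℝ => max (1 - p.2) (1 - p.1)) (ν.prod π) π :=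
    hm.comp Measure.measurePreserving_swap
  have hR : MeasurePreserving (fun p : ℝ × ℝ × ℝ => max (1 - p.2.2) (1 - p.2.1))
      (π.prod (ν.prod π)) π := hswap.comp measurePreserving_snd
  have hY : MeasurePreserving (fun p : ℝ × ℝ × ℝ => p.2.2) (π.prod (ν.prod π)) π :=
    measurePreserving_snd.comp measurePreserving_snd
  -- The chain moves one step from the left variable, using the middle cost; the result is
  -- independent of the untouched right variable. `hT2` is the mirror image.
  have hT1 : MeasurePreserving (fun p : ℝ × ℝ × ℝ => (max (1 - p.1) (1 - p.2.1), p.2.2))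
      (π.prod (ν.prod π)) (π.prod π) :=
    (hm.prod (MeasurePreserving.id π)).comp
      (measurePreserving_prodAssoc π ν π).symm
  have hT2 : MeasurePreserving (fun p : ℝ × ℝ × ℝ => (p.1, max (1 - p.2.2) (1 - p.2.1)))
      (π.prod (ν.prod π)) (π.prod π) := (MeasurePreserving.id π).prod hswap
  have hpair : ∀ᵐ p ∂(π.prod π), p.1 ∈ Icc (0 : ℝ) 1 ∧ p.2 ∈ Icc (0 : ℝ) 1 :=
    (Measure.quasiMeasurePreserving_fst.ae hsupp).and (Measure.quasiMeasurePreserving_snd.ae hsupp)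
  have hX : ∀ᵐ p ∂(π.prod (ν.prod π)), p.1 ∈ Icc (0 : ℝ) 1 :=
    Measure.quasiMeasurePreserving_fst.ae hsupp
  have hZ : ∀ᵐ p ∂(π.prod (ν.prod π)), 0 < p.2.1 :=
    Measure.quasiMeasurePreserving_snd.ae (Measure.quasiMeasurePreserving_fst.ae hpos)
  have hne : ∀ᵐ p ∂(π.prod (ν.prod π)), p.2.1 ≠ p.1 := by
    have hms : MeasurableSet {p : ℝ × ℝ × ℝ | p.2.1 = p.1} :=
      measurableSet_eq_fun (by fun_prop) (by fun_prop)
    have : (π.prod (ν.prod π)) {p : ℝ × ℝ × ℝ | p.2.1 = p.1} = 0 := by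
      rw [Measure.measure_prod_null hms]
      refine ae_of_all _ fun x => ?_
      have : Prod.mk x ⁻¹' {p : ℝ × ℝ × ℝ | p.2.1 = p.1} = {x} ×ˢ univ := by
        ext q; simp
      simp only [this, Measure.prod_prod, measure_singleton, zero_mul, Pi.zero_apply]
    simpa [ae_iff] using this
  set h1 : ℝ × ℝ → ℝ := fun p => if 1 < p.1 + p.2 then p.1 - p.2 else 0 with hh1
  set h2 : ℝ × ℝ → ℝ := fun p => if p.1 + p.2 < 1 then p.1 - p.2 else 0 with hh2
  have m1 : Measurable h1 :=
    Measurable.ite (measurableSet_lt (by fun_prop) (by fun_prop)) (by fun_prop) (by fun_prop)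
  have m2 : Measurable h2 :=
    Measurable.ite (measurableSet_lt (by fun_prop) (by fun_prop)) (by fun_prop) (by fun_prop)
  have i1 : Integrable h1 (π.prod π) := Integrable.of_bound m1.aestronglyMeasurable 1 <| by
    filter_upwards [hpair] with p hp
    obtain ⟨⟨a, b⟩, c, d⟩ := hp
    rw [Real.norm_eq_abs, abs_le, hh1]
    dsimp only
    split_ifs <;> constructor <;> linarith
  have i2 : Integrable h2 (π.prod π) := Integrable.of_bound m2.aestronglyMeasurable 1 <| by
    filter_upwards [hpair] with p hp
    obtain ⟨⟨a, b⟩, c, d⟩ := hp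
    rw [Real.norm_eq_abs, abs_le, hh2]
    dsimp only
    split_ifs <;> constructor <;> linarith
  have z1 : ∫ p, h1 p ∂(π.prod π) = 0 := integral_prod_eq_zero_of_swap_eq_neg fun p => by
    simp only [hh1, Prod.fst_swap, Prod.snd_swap, add_comm p.2]
    split_ifs <;> ring
  have z2 : ∫ p, h2 p ∂(π.prod π) = 0 := integral_prod_eq_zero_of_swap_eq_neg fun p => by
    simp only [hh2, Prod.fst_swap, Prod.snd_swap, add_comm p.2]
    split_ifs <;> ring
  have pull : ∀ {T : ℝ × ℝ × ℝ → ℝ × ℝ} {h : ℝ × ℝ → ℝ}, Measurable h →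
      MeasurePreserving T (π.prod (ν.prod π)) (π.prod π) →
      ∫ p, h (T p) ∂(π.prod (ν.prod π)) = ∫ q, h q ∂(π.prod π) := fun mh hT => by
    rw [← hT.map_eq, integral_map hT.measurable.aemeasurable mh.aestronglyMeasurable]
  have pull' : ∀ {T : ℝ × ℝ × ℝ → ℝ}, MeasurePreserving T (π.prod (ν.prod π)) π →
      ∫ p, T p ∂(π.prod (ν.prod π)) = ∫ x, x ∂π := fun {T} hT => by
    conv_rhs => rw [← hT.map_eq]
    rw [integral_map hT.measurable.aemeasurable (by fun_prop)]
  have hms : MeasurableSet {p : ℝ × ℝ × ℝ | p.2.1 < min p.1 p.2.2} :=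
    measurableSet_lt (by fun_prop) (by fun_prop)
  have iA : Integrable (fun p : ℝ × ℝ × ℝ => if p.2.1 < min p.1 p.2.2 then (1 : ℝ) else 0)
      (π.prod (ν.prod π)) :=
    Integrable.of_bound (Measurable.ite hms (by fun_prop) (by fun_prop)).aestronglyMeasurable 1 <|
      ae_of_all _ fun p => by split_ifs <;> simp
  have iB : Integrable (fun p : ℝ × ℝ × ℝ => if p.2.1 < min p.1 p.2.2 then p.2.1 else 0)
      (π.prod (ν.prod π)) := by
    refine Integrable.of_bound
      (Measurable.ite hms (by fun_prop) (by fun_prop)).aestronglyMeasurable 1 ?_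
    filter_upwards [hX, hZ] with p hx hz
    split_ifs with h
    · rw [Real.norm_eq_abs, abs_of_pos hz]
      exact (h.le.trans (min_le_left _ _)).trans hx.2
    · simp
  have eA : ∫ p : ℝ × ℝ × ℝ, (if p.2.1 < min p.1 p.2.2 then (1 : ℝ) else 0) ∂(π.prod (ν.prod π))
      = (π.prod (ν.prod π)).real {p | p.2.1 < min p.1 p.2.2} := by
    rw [← integral_indicator_one hms]
    rfl
  have hid := integral_congr_ae (μ := π.prod (ν.prod π))
    (hne.mono fun p hp => posPart_sub_eq (y := p.2.2) hp)
  have jY : Integrable (fun p : ℝ × ℝ × ℝ => p.2.2) (π.prod (ν.prod π)) :=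
    hY.integrable_comp_of_integrable hint
  have jR : Integrable (fun p : ℝ × ℝ × ℝ => max (1 - p.2.2) (1 - p.2.1)) (π.prod (ν.prod π)) :=
    hR.integrable_comp_of_integrable hint
  have j1 := hT1.integrable_comp_of_integrable i1
  have j2 := hT2.integrable_comp_of_integrable i2
  have e1 := pull m1 hT1
  have e2 := pull m2 hT2
  rw [z1] at e1
  rw [z2] at e2
  simp only [Function.comp_def, hh1, hh2] at j1 j2 e1 e2
  have k1 : Integrable (fun p : ℝ × ℝ × ℝ => p.2.2 - 1) (π.prod (ν.prod π)) :=
    jY.sub (integrable_const 1)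
  have k2 : Integrable (fun p : ℝ × ℝ × ℝ => (if p.2.1 < min p.1 p.2.2 then (1 : ℝ) else 0)
      - 2 * (if p.2.1 < min p.1 p.2.2 then p.2.1 else 0)) (π.prod (ν.prod π)) :=
    iA.sub (iB.const_mul 2)
  have k3 : Integrable (fun p : ℝ × ℝ × ℝ => (if p.2.1 < min p.1 p.2.2 then (1 : ℝ) else 0)
      - 2 * (if p.2.1 < min p.1 p.2.2 then p.2.1 else 0)
      - (if 1 < max (1 - p.1) (1 - p.2.1) + p.2.2 then max (1 - p.1) (1 - p.2.1) - p.2.2 else 0))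
      (π.prod (ν.prod π)) := k2.sub j1
  rw [integral_add k1 jR, integral_sub jY (integrable_const 1),
    pull' hY, pull' hR, integral_sub k3 j2, integral_sub k2 j1,
    integral_sub iA (iB.const_mul 2), e1, e2,
    integral_const_mul, eA] at hid
  simp only [integral_const, probReal_univ, smul_eq_mul, mul_one] at hid
  rw [limitConst]
  linarith

end Invariant

/-! ### Exponential costs -/

/-- For exponential costs the product of the survival functions at `t` and `1 - t` is the constant
`exp (-r)`, so the stationary tail is elementary and is integrated over `[0, 1]`. -/
theorem mean_stationaryLaw_exp {ν : Measure ℝ} [IsProbabilityMeasure ν] [NullSingletonClass ν]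
    (hG : 0 < cdf ν (1 / 2)) (hsupp : ∀ᵐ x ∂(stationaryLaw ν hG), x ∈ Icc (0 : ℝ) 1)
    {r : ℝ} (hr : 0 < r) (hν : ν = expMeasure r) :
    ∫ x, x ∂(stationaryLaw ν hG) = (1 - Real.exp (-r))⁻¹ - r⁻¹ := by
  have hE : 1 - Real.exp (-r) ≠ 0 := by
    have : Real.exp (-r) < 1 := by
      rw [← Real.exp_zero]; exact Real.exp_lt_exp.2 (by linarith)
    linarith
  rw [Integrable.integral_eq_integral_Ioc_meas_le (M := 1) (integrable_id_of_ae_mem hsupp)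
    (hsupp.mono fun x hx => hx.1) (hsupp.mono fun x hx => hx.2)]
  have hval : ∀ t ∈ Ioc (0 : ℝ) 1, (stationaryLaw ν hG).real {a | t ≤ a}
      = (1 - Real.exp (-(r * (1 - t)))) / (1 - Real.exp (-r)) := by
    intro t ht
    have h1 : cdf ν t = 1 - Real.exp (-(r * t)) := by
      rw [hν, cdf_expMeasure_eq hr, if_pos ht.1.le]
    have h2 : cdf ν (1 - t) = 1 - Real.exp (-(r * (1 - t))) := by
      rw [hν, cdf_expMeasure_eq hr, if_pos (by linarith [ht.2])]
    have h3 : Real.exp (-(r * t)) * Real.exp (-(r * (1 - t))) = Real.exp (-r) := by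
      rw [← Real.exp_add]; ring_nf
    have h4 : (stationaryLaw ν hG).real {a | t ≤ a} = 1 - cdf (stationaryLaw ν hG) t := by
      rw [← measureReal_Iio_eq, ← measureReal_Ici_eq]
      rfl
    rw [h4, cdf_stationaryLaw, h1, h2, sub_sub_cancel, sub_sub_cancel, h3, one_sub_div hE]
    congr 1
    linear_combination h3
  rw [setIntegral_congr_fun measurableSet_Ioc hval,
    ← intervalIntegral.integral_of_le zero_le_one]
  have hderiv : ∀ t ∈ uIcc (0 : ℝ) 1, HasDerivAt
      (fun t => (t - Real.exp (-(r * (1 - t))) / r) / (1 - Real.exp (-r)))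
      ((1 - Real.exp (-(r * (1 - t)))) / (1 - Real.exp (-r))) t := by
    intro t _
    have h1 : HasDerivAt (fun t : ℝ => -(r * (1 - t))) r t := by
      have h := (((hasDerivAt_id t).const_sub 1).const_mul r).neg
      rw [mul_neg, mul_one, neg_neg] at h
      exact h
    have h2 := (((hasDerivAt_id t).sub (h1.exp.div_const r)).div_const (1 - Real.exp (-r)))
    rw [mul_div_cancel_right₀ _ hr.ne'] at h2
    exact h2
  rw [intervalIntegral.integral_eq_sub_of_hasDerivAt hderiv
    (Continuous.intervalIntegrable (by fun_prop) _ _)]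
  simp only [sub_self, mul_zero, neg_zero, Real.exp_zero, sub_zero, mul_one]
  field_simp
  ring

/-! ### Random costs: independence, blocks and the law of the chain -/

@[fun_prop]
theorem measurable_chain (s : ℝ) (n : ℕ) : Measurable fun x : ℕ → ℝ => chain x s n := by
  induction n with
  | zero => exact measurable_const
  | succ n ih => exact (ih.const_sub 1).max ((measurable_pi_apply (n + 1)).const_sub 1)

@[fun_prop]
theorem measurable_chainSum (s : ℝ) (n : ℕ) : Measurable fun x : ℕ → ℝ => chainSum x s n :=
  Finset.measurable_fun_sum _ fun k _ => measurable_chain s k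

/-- The sequence of costs with given values at `1, …, n` and zeros elsewhere. -/
def costsOfFin {n : ℕ} (v : Fin n → ℝ) (k : ℕ) : ℝ :=
  -- Truncated subtraction sends `k = 0` to the first entry too; this is harmless, as the chain
  -- never reads its cost at `0`.
  if h : k - 1 < n then v ⟨k - 1, h⟩ else 0

@[fun_prop]
theorem measurable_costsOfFin (n : ℕ) : Measurable (costsOfFin (n := n)) := by
  refine measurable_pi_lambda _ fun k => ?_
  unfold costsOfFin
  split_ifs <;> fun_prop

theorem chain_costsOfFin (x : ℕ → ℝ) (s : ℝ) (n : ℕ) :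
    chain (costsOfFin fun k : Fin n => x (k + 1)) s n = chain x s n :=
  chain_congr fun k h1 h2 => by
    rw [costsOfFin, dif_pos (by omega)]
    simp only [Nat.sub_add_cancel h1]

theorem chainSum_costsOfFin (x : ℕ → ℝ) (s : ℝ) (n : ℕ) :
    chainSum (costsOfFin fun k : Fin n => x (k + 1)) s n = chainSum x s n :=
  chainSum_congr fun k h1 h2 => by
    rw [costsOfFin, dif_pos (by omega)]
    simp only [Nat.sub_add_cancel h1]

section Blocks

variable {Ω : Type*} [MeasurableSpace Ω] {μ : Measure Ω} {ν : Measure ℝ}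
  {ξ : ℕ → Ω → ℝ}

theorem indepFun_blocks {η : ℕ → Ω → ℝ} (hη : ∀ i, AEMeasurable (η i) μ) (hind : iIndepFun η μ)
    {p a q : ℕ} (b : ℕ) (hpq : p + a ≤ q) :
    IndepFun (fun ω (k : Fin a) => η (p + k) ω) (fun ω (k : Fin b) => η (q + k) ω) μ := by
  have hdis : Disjoint (Finset.Ico p (p + a)) (Finset.Ico q (q + b)) := by
    rw [Finset.disjoint_left]
    intro i hi hi'
    rw [Finset.mem_Ico] at hi hi'
    omega
  have h := hind.indepFun_finset₀ _ _ hdis hη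
  have m1 : Measurable fun (v : Finset.Ico p (p + a) → ℝ) (k : Fin a) =>
      v ⟨p + k, by rw [Finset.mem_Ico]; omega⟩ := by fun_prop
  have m2 : Measurable fun (v : Finset.Ico q (q + b) → ℝ) (k : Fin b) =>
      v ⟨q + k, by rw [Finset.mem_Ico]; omega⟩ := by fun_prop
  exact h.comp m1 m2

theorem map_block [IsProbabilityMeasure μ] {η : ℕ → Ω → ℝ} (hη : ∀ i, HasLaw (η i) ν μ)
    (hind : iIndepFun η μ)
    (p a : ℕ) : μ.map (fun ω (k : Fin a) => η (p + k) ω) = Measure.pi fun _ => ν := by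
  have hinj : Function.Injective fun k : Fin a => p + (k : ℕ) := fun i j h => by
    simpa [Fin.ext_iff] using h
  rw [(iIndepFun_iff_map_fun_eq_pi_map fun k : Fin a => (hη (p + k)).aemeasurable).1
    (hind.precomp hinj)]
  simp only [(hη _).map_eq]

theorem aemeasurable_block {η : ℕ → Ω → ℝ} (hη : ∀ i, AEMeasurable (η i) μ) (p a : ℕ) :
    AEMeasurable (fun ω (k : Fin a) => η (p + k) ω) μ :=
  aemeasurable_pi_lambda _ fun k => hη (p + k)

/-- The law of the chain at time `k`, as a kernel in the starting point. -/
noncomputable def chainKernelIter (ν : Measure ℝ) [IsProbabilityMeasure ν] : ℕ → Kernel ℝ ℝ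
  | 0 => Kernel.id
  | k + 1 => chainKernel ν ∘ₖ chainKernelIter ν k

instance isMarkovKernel_chainKernelIter [IsProbabilityMeasure ν] (k : ℕ) :
    IsMarkovKernel (chainKernelIter ν k) := by
  induction k with
  | zero => exact inferInstanceAs (IsMarkovKernel Kernel.id)
  | succ k ih => exact inferInstanceAs (IsMarkovKernel (chainKernel ν ∘ₖ chainKernelIter ν k))

theorem invariant_chainKernelIter [IsProbabilityMeasure ν] {π : Measure ℝ}
    (hinv : (chainKernel ν).Invariant π) (k : ℕ) :
    (chainKernelIter ν k).Invariant π := by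
  induction k with
  | zero => exact Measure.id_comp
  | succ k ih => exact hinv.comp ih

/-- The second marginal of `π ⊗ₘ κ` is `π`, so a stationary start has the stationary mean at every
time. -/
theorem integral_kernel_of_invariant {π : Measure ℝ} [IsProbabilityMeasure π] {κ : Kernel ℝ ℝ}
    [IsMarkovKernel κ] (hκ : κ.Invariant π) (hint : Integrable (fun x => x) π) :
    Integrable (fun s => ∫ y, y ∂(κ s)) π ∧ ∫ s, ∫ y, y ∂(κ s) ∂π = ∫ x, x ∂π := by
  have h : Integrable (fun p : ℝ × ℝ => p.2) (π ⊗ₘ κ) :=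
    (Measure.integrable_compProd_snd_iff (f := fun x => x) (by fun_prop)).2
      (by rw [show κ ∘ₘ π = π from hκ.def]; exact hint)
  have h' : Integrable (fun x => x) ((κ ∘ₖ Kernel.const Unit π) ()) := by
    rw [← Measure.comp_eq_comp_const_apply]
    exact (show κ ∘ₘ π = π from hκ.def).symm ▸ hint
  refine ⟨h'.integral_comp, ?_⟩
  rw [← Measure.integral_compProd h]
  have h2 : (π ⊗ₘ κ).map Prod.snd = π := by
    rw [← Measure.snd, Measure.snd_compProd]; exact hκ.def
  conv_rhs => rw [← h2]
  rw [integral_map (by fun_prop) (by fun_prop)]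

theorem aemeasurable_chain
    (hlaw : ∀ i, 1 ≤ i → HasLaw (ξ i) ν μ)
    (s : ℝ) (n : ℕ) :
    AEMeasurable (fun ω => chain (fun k => ξ k ω) s n) μ := by
  have h := (measurable_chain s n).comp_aemeasurable ((measurable_costsOfFin n).comp_aemeasurable
    (aemeasurable_block (fun i => (hlaw (i + 1) (by omega)).aemeasurable) 0 n))
  refine h.congr (ae_of_all _ fun ω => ?_)
  simp only [Function.comp, zero_add]
  exact chain_costsOfFin (fun k => ξ k ω) s n

/-- The chain at time `n` is a function of the costs `1, …, n`, hence independent of the fresh cost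
`n + 1`. -/
theorem map_chain [IsProbabilityMeasure μ] [IsProbabilityMeasure ν]
    (hlaw : ∀ i, 1 ≤ i → HasLaw (ξ i) ν μ)
    (hindep : iIndepFun (fun i : ℕ => ξ (i + 1)) μ)
    (s : ℝ) (n : ℕ) :
    μ.map (fun ω => chain (fun k => ξ k ω) s n) = chainKernelIter ν n s := by
  induction n with
  | zero => simp [chain, chainKernelIter, Measure.map_const, Kernel.id_apply]
  | succ n ih =>
    have hmeas : ∀ i, AEMeasurable (ξ (i + 1)) μ :=
      fun i => (hlaw (i + 1) (by omega)).aemeasurable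
    have hi := (indepFun_blocks hmeas hindep (p := 0) (a := n) (q := n) 1 (by omega)).comp
      ((measurable_chain s n).comp (measurable_costsOfFin n)) (measurable_pi_apply 0)
    have hi' : IndepFun (fun ω => chain (fun k => ξ k ω) s n) (ξ (n + 1)) μ := by
      refine hi.congr (ae_of_all _ fun ω => ?_) (ae_of_all _ fun ω => rfl)
      simp only [Function.comp, zero_add]
      exact chain_costsOfFin (fun k => ξ k ω) s n
    have hprod := (indepFun_iff_map_prod_eq_prod_map_map (aemeasurable_chain hlaw s n)
      (hmeas n)).1 hi'
    rw [ih, (hlaw (n + 1) (by omega)).map_eq] at hprod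
    rw [chainKernelIter, Kernel.comp_apply, bind_chainKernel, ← hprod,
      AEMeasurable.map_map_of_aemeasurable (by fun_prop)
        ((aemeasurable_chain hlaw s n).prodMk (hmeas n))]
    rfl

theorem ae_forall_cost_nonneg
    (hlaw : ∀ i, 1 ≤ i → HasLaw (ξ i) ν μ)
    (hpos : ∀ᵐ z ∂ν, 0 < z) : ∀ᵐ ω ∂μ, ∀ k, 1 ≤ k → 0 ≤ ξ k ω := by
  rw [ae_all_iff]
  intro k
  rw [ae_all_iff]
  intro hk
  have h : ∀ᵐ z ∂(μ.map (ξ k)), 0 < z := by rwa [(hlaw k hk).map_eq]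
  exact (ae_of_ae_map (hlaw k hk).aemeasurable h).mono fun ω hω => hω.le

theorem integrable_chain [IsProbabilityMeasure μ]
    (hlaw : ∀ i, 1 ≤ i → HasLaw (ξ i) ν μ)
    (hpos : ∀ᵐ z ∂ν, 0 < z) {s : ℝ} (hs : s ∈ Icc (0 : ℝ) 1) (n : ℕ) :
    Integrable (fun ω => chain (fun k => ξ k ω) s n) μ := by
  refine Integrable.of_bound (aemeasurable_chain hlaw s n).aestronglyMeasurable 1 ?_
  filter_upwards [ae_forall_cost_nonneg hlaw hpos] with ω hω
  have h := chain_mem_Icc (x := fun k => ξ k ω) hω hs n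
  rw [Real.norm_eq_abs, abs_of_nonneg h.1]
  exact h.2

theorem integrable_chainSum [IsProbabilityMeasure μ]
    (hlaw : ∀ i, 1 ≤ i → HasLaw (ξ i) ν μ)
    (hpos : ∀ᵐ z ∂ν, 0 < z) {s : ℝ} (hs : s ∈ Icc (0 : ℝ) 1) (n : ℕ) :
    Integrable (fun ω => chainSum (fun k => ξ k ω) s n) μ :=
  integrable_finsetSum _ fun k _ => integrable_chain hlaw hpos hs k

/-- The expected sum `e s` from start `s` averages under `π` to `m` times the stationary mean, while
`e 1` and `e s` differ by at most `1` for `s` in `[0, 1]`. -/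
theorem abs_integral_chainSum_sub_le [IsProbabilityMeasure μ] [IsProbabilityMeasure ν]
    (hlaw : ∀ i, 1 ≤ i → HasLaw (ξ i) ν μ)
    (hindep : iIndepFun (fun i : ℕ => ξ (i + 1)) μ)
    (hpos : ∀ᵐ z ∂ν, 0 < z) {π : Measure ℝ}
    [IsProbabilityMeasure π] (hinv : (chainKernel ν).Invariant π)
    (hsupp : ∀ᵐ x ∂π, x ∈ Icc (0 : ℝ) 1) (m : ℕ) :
    |∫ ω, chainSum (fun k => ξ k ω) 1 m ∂μ - m * ∫ x, x ∂π| ≤ 1 := by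
  -- Defining `e` through kernels lets its `π`-integrability come from invariance; it is an expected
  -- sum over `μ` only for `s` in `[0, 1]`, which carries `π`.
  set e : ℝ → ℝ := fun s => ∑ k ∈ Finset.range m, ∫ y, y ∂(chainKernelIter ν k s) with he
  have hk := fun k => integral_kernel_of_invariant (invariant_chainKernelIter hinv k)
    (integrable_id_of_ae_mem hsupp)
  have hei : Integrable e π := integrable_finsetSum _ fun k _ => (hk k).1
  have he1 : ∫ s, e s ∂π = m * ∫ x, x ∂π := by
    rw [he, integral_finsetSum _ fun k _ => (hk k).1]
    simp [(hk _).2]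
  have he2 : ∀ s ∈ Icc (0 : ℝ) 1, e s = ∫ ω, chainSum (fun k => ξ k ω) s m ∂μ := by
    intro s hs
    simp only [he, chainSum]
    rw [integral_finsetSum _ fun k _ => integrable_chain hlaw hpos hs k]
    refine Finset.sum_congr rfl fun k _ => ?_
    rw [← map_chain hlaw hindep, integral_map (aemeasurable_chain hlaw s k) (by fun_prop)]
  have h1 : (1 : ℝ) ∈ Icc (0 : ℝ) 1 := by simp
  have he3 : ∀ s ∈ Icc (0 : ℝ) 1, ‖e 1 - e s‖ ≤ 1 := by
    intro s hs
    rw [he2 s hs, he2 1 h1, ← integral_sub (integrable_chainSum hlaw hpos h1 m)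
      (integrable_chainSum hlaw hpos hs m)]
    have := norm_integral_le_of_norm_le_const (μ := μ) (C := 1) (f := fun ω =>
      chainSum (fun k => ξ k ω) 1 m - chainSum (fun k => ξ k ω) s m) (ae_of_all _ fun ω => by
        refine (abs_chainSum_sub_le _ _ _ _).trans ?_
        rw [abs_of_nonneg (by linarith [hs.2])]
        linarith [hs.1])
    simpa using this
  have he4 : ∫ s, (e 1 - e s) ∂π = e 1 - m * ∫ x, x ∂π := by
    rw [integral_sub (integrable_const _) hei, he1]
    simp
  rw [← he2 1 h1, ← he4]
  simpa using norm_integral_le_of_norm_le_const (μ := π) (hsupp.mono he3)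

/-- Each restarted block sum is the same function of its own `m` costs, so the sums are i.i.d. and
the strong law applies. -/
theorem ae_tendsto_block_average [IsProbabilityMeasure μ]
    (hlaw : ∀ i, 1 ≤ i → HasLaw (ξ i) ν μ)
    (hindep : iIndepFun (fun i : ℕ => ξ (i + 1)) μ)
    (hpos : ∀ᵐ z ∂ν, 0 < z) (m : ℕ) : ∀ᵐ ω ∂μ,
    Tendsto (fun j : ℕ => (∑ i ∈ Finset.range j, chainSum (fun k => ξ (i * m + k) ω) 1 m) / (j : ℝ))
      atTop (𝓝 (∫ ω, chainSum (fun k => ξ k ω) 1 m ∂μ)) := by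
  have hmeas : ∀ i, AEMeasurable (ξ (i + 1)) μ :=
    fun i => (hlaw (i + 1) (by omega)).aemeasurable
  have hH : Measurable fun v : Fin m → ℝ => chainSum (costsOfFin v) 1 m :=
    (measurable_chainSum 1 m).comp (measurable_costsOfFin m)
  have hY : ∀ i : ℕ, (fun ω => chainSum (fun k => ξ (i * m + k) ω) 1 m)
      = (fun v : Fin m → ℝ => chainSum (costsOfFin v) 1 m) ∘
        fun ω (k : Fin m) => ξ (i * m + k + 1) ω := fun i => by
    ext ω
    exact (chainSum_costsOfFin (fun k => ξ (i * m + k) ω) 1 m).symm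
  have hlt : ∀ i j : ℕ, i < j → IndepFun (fun ω => chainSum (fun k => ξ (i * m + k) ω) 1 m)
      (fun ω => chainSum (fun k => ξ (j * m + k) ω) 1 m) μ := fun i j hij => by
    rw [hY, hY]
    refine (indepFun_blocks hmeas hindep (p := i * m) (a := m) (q := j * m) m ?_).comp hH hH
    calc i * m + m = (i + 1) * m := by ring
      _ ≤ j * m := Nat.mul_le_mul_right m hij
  have hint : Integrable (fun ω => chainSum (fun k => ξ (0 * m + k) ω) 1 m) μ := by
    simpa using integrable_chainSum hlaw hpos (s := 1) (by simp) m
  have hid : ∀ i : ℕ, IdentDistrib (fun ω => chainSum (fun k => ξ (i * m + k) ω) 1 m)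
      (fun ω => chainSum (fun k => ξ (0 * m + k) ω) 1 m) μ μ := fun i => by
    rw [hY, hY]
    refine IdentDistrib.comp ⟨aemeasurable_block hmeas _ m, aemeasurable_block hmeas _ m, ?_⟩ hH
    rw [map_block (fun i => hlaw (i + 1) (by omega)) hindep,
      map_block (fun i => hlaw (i + 1) (by omega)) hindep]
  have h := strong_law_ae_real _ hint
    (fun i j hij => (lt_or_gt_of_ne hij).elim (hlt i j) fun h => (hlt j i h).symm) hid
  simpa using h

/-! ### Almost sure and `L¹` convergence -/

theorem maxBenefit_ae_eq
    (hlaw : ∀ i, 1 ≤ i → HasLaw (ξ i) ν μ)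
    (hpos : ∀ᵐ z ∂ν, 0 < z) : ∀ᵐ ω ∂μ, ∀ n,
    maxBenefit (fun i => ξ i ω) n = chainSum (fun i => ξ i ω) 1 n :=
  (ae_forall_cost_nonneg hlaw hpos).mono fun _ hω n => maxBenefit_eq_chainSum hω n

theorem ae_tendsto_maxBenefit [IsProbabilityMeasure μ] [IsProbabilityMeasure ν]
    (hlaw : ∀ i, 1 ≤ i → HasLaw (ξ i) ν μ)
    (hindep : iIndepFun (fun i : ℕ => ξ (i + 1)) μ)
    (hpos : ∀ᵐ z ∂ν, 0 < z) {π : Measure ℝ}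
    [IsProbabilityMeasure π] (hinv : (chainKernel ν).Invariant π)
    (hsupp : ∀ᵐ x ∂π, x ∈ Icc (0 : ℝ) 1) : ∀ᵐ ω ∂μ,
    Tendsto (fun n : ℕ => maxBenefit (fun i => ξ i ω) n / (n : ℝ)) atTop (𝓝 (∫ x, x ∂π)) := by
  filter_upwards [ae_all_iff.2 (ae_tendsto_block_average hlaw hindep hpos),
    ae_forall_cost_nonneg hlaw hpos] with ω hω hnn
  simp only [maxBenefit_eq_chainSum (x := fun i => ξ i ω) hnn]
  refine tendsto_div_of_block_averages (chainSum_le_chainSum_add (x := fun i => ξ i ω) hnn)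
    fun m _ => ⟨_, _, abs_integral_chainSum_sub_le hlaw hindep hpos hinv hsupp m, hω m, ?_⟩
  intro j
  have h := abs_chainSum_mul_sub_le (x := fun i => ξ i ω) hnn m j
  rcases Nat.eq_zero_or_pos j with rfl | hj
  · simp [chainSum]
  · rwa [mul_div_cancel₀ _ (by positivity)]

theorem ae_maxBenefit_div_mem
    (hlaw : ∀ i, 1 ≤ i → HasLaw (ξ i) ν μ)
    (hpos : ∀ᵐ z ∂ν, 0 < z) : ∀ᵐ ω ∂μ, ∀ n : ℕ,
    maxBenefit (fun i => ξ i ω) n / (n : ℝ) ∈ Icc (0 : ℝ) 1 := by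
  filter_upwards [ae_forall_cost_nonneg hlaw hpos] with ω hω n
  have h := chainSum_mem_Icc (x := fun i => ξ i ω) hω n
  rw [maxBenefit_eq_chainSum (x := fun i => ξ i ω) hω]
  exact ⟨div_nonneg h.1 n.cast_nonneg, div_le_one_of_le₀ h.2 n.cast_nonneg⟩

theorem integrable_maxBenefit_div [IsProbabilityMeasure μ]
    (hlaw : ∀ i, 1 ≤ i → HasLaw (ξ i) ν μ)
    (hpos : ∀ᵐ z ∂ν, 0 < z) (n : ℕ) :
    Integrable (fun ω => maxBenefit (fun i => ξ i ω) n / (n : ℝ)) μ :=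
  ((integrable_chainSum hlaw hpos (s := 1) (by simp) n).congr
    ((maxBenefit_ae_eq hlaw hpos).mono fun _ hω => (hω n).symm)).div_const _

/-- Dominated convergence: the ratio lies in `[0, 1]` almost surely, so `1 + |c|` dominates. -/
theorem tendsto_integral_abs_sub_of_ae [IsProbabilityMeasure μ]
    (hlaw : ∀ i, 1 ≤ i → HasLaw (ξ i) ν μ)
    (hpos : ∀ᵐ z ∂ν, 0 < z) {c : ℝ}
    (h : ∀ᵐ ω ∂μ, Tendsto (fun n : ℕ => maxBenefit (fun i => ξ i ω) n / (n : ℝ)) atTop (𝓝 c)) :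
    Tendsto (fun n : ℕ => ∫ ω, |maxBenefit (fun i => ξ i ω) n / (n : ℝ) - c| ∂μ) atTop (𝓝 0) := by
  have := tendsto_integral_of_dominated_convergence (μ := μ)
    (F := fun (n : ℕ) ω => |maxBenefit (fun i => ξ i ω) n / (n : ℝ) - c|) (f := fun _ => 0)
    (fun _ => 1 + |c|)
    (fun n => ((integrable_maxBenefit_div hlaw hpos n).sub
      (integrable_const c)).abs.aestronglyMeasurable)
    (integrable_const _)
    (fun n => (ae_maxBenefit_div_mem hlaw hpos).mono fun ω hω => by
      have h1 := hω n
      rw [Real.norm_eq_abs, abs_abs]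
      refine (abs_sub _ _).trans ?_
      rw [abs_of_nonneg h1.1]
      linarith [h1.2])
    (h.mono fun ω hω => by simpa using (hω.sub_const c).abs)
  simpa using this

end Blocks

/-! ### The density hypothesis and the main theorem -/

/-- By continuity the density is positive on an interval ending at `1/2`, which therefore has
positive mass. -/
theorem cdf_withDensity_half_pos {ν : Measure ℝ} [IsProbabilityMeasure ν] {g : ℝ → ℝ}
    (hg_meas : Measurable g)
    (hg_cont : ContinuousOn g (Ioi 0)) (hg_half : 0 < g (1 / 2))
    (hν : ν = volume.withDensity fun x => ENNReal.ofReal (g x)) : 0 < cdf ν (1 / 2) := by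
  have hc : ContinuousAt g (1 / 2) := hg_cont.continuousAt (Ioi_mem_nhds (by norm_num))
  obtain ⟨δ, hδ, hball⟩ := Metric.eventually_nhds_iff.1 (hc.eventually (lt_mem_nhds hg_half))
  refine (cdf_nonneg _ _).lt_of_ne fun h => ?_
  have h0 : ν (Iic (1 / 2)) = 0 := by rw [← ofReal_cdf, ← h, ENNReal.ofReal_zero]
  have h1 : ν (Ioc (1 / 2 - δ / 2) (1 / 2)) = 0 := measure_mono_null Ioc_subset_Iic_self h0
  have hpos : ∀ x ∈ Ioc (1 / 2 - δ / 2) (1 / 2), 0 < g x := fun x hx => hball <| by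
    rw [Real.dist_eq, abs_lt]
    constructor <;> linarith [hx.1, hx.2]
  rw [hν, withDensity_apply _ measurableSet_Ioc, lintegral_eq_zero_iff hg_meas.ennreal_ofReal,
    Filter.EventuallyEq, ae_restrict_iff' measurableSet_Ioc] at h1
  have h2 : volume (Ioc (1 / 2 - δ / 2) (1 / 2 : ℝ)) = 0 := by
    refine measure_mono_null (fun x hx => ?_) (ae_iff.1 h1)
    simpa only [mem_ofPred_eq, Classical.not_imp, Pi.zero_apply, ENNReal.ofReal_eq_zero, not_le]
      using ⟨hx, hpos x hx⟩
  rw [Real.volume_Ioc, ENNReal.ofReal_eq_zero] at h2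
  linarith

theorem theorem1 {Ω : Type*} [MeasurableSpace Ω] (μ : Measure Ω) [IsProbabilityMeasure μ]
    -- `ν` is the common law of the costs; it is carried by `(0, ∞)`
    (ν : Measure ℝ) [IsProbabilityMeasure ν] (hpos : ν (Iic 0) = 0)
    -- `ν` has a density that is bounded and continuous on `(0, ∞)` and positive at `1/2`
    (g : ℝ → ℝ) (hg_meas : Measurable g) (hg_nonneg : ∀ x, 0 ≤ g x)
    (hg_bdd : ∃ C : ℝ, ∀ x, g x ≤ C) (hg_cont : ContinuousOn g (Ioi 0)) (hg_half : 0 < g (1 / 2))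
    (hν : ν = volume.withDensity fun x => ENNReal.ofReal (g x))
    -- `ξ 1, ξ 2, …` are independent with law `ν` (`ξ 0` is not used)
    (ξ : ℕ → Ω → ℝ) (hlaw : ∀ i, 1 ≤ i → HasLaw (ξ i) ν μ)
    (hindep : iIndepFun (fun i : ℕ => ξ (i + 1)) μ) :
    ∃ π : Measure ℝ, IsProbabilityMeasure π ∧
      -- `π` is the unique stationary law of the chain, is carried by `[0, 1]`, and
      -- has an explicit distribution function
      (chainKernel ν).Invariant π ∧
      (∀ ρ : Measure ℝ, IsProbabilityMeasure ρ → (chainKernel ν).Invariant ρ → ρ = π) ∧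
      π (Icc 0 1) = 1 ∧
      (∀ x : ℝ, (1 - cdf ν x) * (1 - cdf ν (1 - x)) < 1 ∧
        cdf π x = (1 - cdf ν (1 - x)) * cdf ν x /
          (1 - (1 - cdf ν x) * (1 - cdf ν (1 - x)))) ∧
      ∃ c : ℝ, 1 / 2 ≤ c ∧ c ≤ 1 ∧
        -- almost sure convergence
        (∀ᵐ ω ∂μ, Tendsto (fun n : ℕ => maxBenefit (fun i => ξ i ω) n / (n : ℝ)) atTop (𝓝 c)) ∧
        -- convergence in `L¹`
        (∀ n : ℕ, Integrable (fun ω => maxBenefit (fun i => ξ i ω) n / (n : ℝ)) μ) ∧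
        Tendsto (fun n : ℕ => ∫ ω, |maxBenefit (fun i => ξ i ω) n / (n : ℝ) - c| ∂μ)
          atTop (𝓝 0) ∧
        c = limitConst ν π ∧
        (∀ r : ℝ, 0 < r → ν = expMeasure r → c = (1 - Real.exp (-r))⁻¹ - r⁻¹) := by
  have : NullSingletonClass ν := by rw [hν]; infer_instance
  have hG := cdf_withDensity_half_pos hg_meas hg_cont hg_half hν
  have hpos' : ∀ᵐ z ∂ν, 0 < z := by
    rw [ae_iff]
    simp only [not_lt]
    exact hpos
  have h0 : cdf ν 0 = 0 := by rw [cdf_eq_real, measureReal_def, hpos, ENNReal.toReal_zero]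
  have hIcc := stationaryLaw_Icc ν hG h0
  have hsupp : ∀ᵐ x ∂(stationaryLaw ν hG), x ∈ Icc (0 : ℝ) 1 :=
    mem_ae_iff_prob_eq_one measurableSet_Icc |>.2 hIcc
  have hinv := invariant_stationaryLaw ν hG
  have hae := ae_tendsto_maxBenefit hlaw hindep hpos' hinv hsupp
  exact ⟨stationaryLaw ν hG, inferInstance, hinv,
    fun ρ _ hρ => eq_stationaryLaw_of_invariant ν hG ρ hρ, hIcc,
    fun x => ⟨cdf_survival_mul_lt_one ν hG x, cdf_stationaryLaw ν hG x⟩,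
    ∫ x, x ∂(stationaryLaw ν hG), half_le_mean hinv hsupp, mean_le_one hsupp, hae,
    integrable_maxBenefit_div hlaw hpos', tendsto_integral_abs_sub_of_ae hlaw hpos' hae,
    mean_eq_limitConst hpos' hinv hsupp,
    fun r hr hexp => mean_stationaryLaw_exp hG hsupp hr hexp⟩
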